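/- Let $\Omega_n=\{0,1\}^n$ with the uniform probability measure $\mu$. For $\mathcal A,\mathcal B\subset\Omega_n$ put $\mathrm{Cov}(\mathcal A,\mathcal B)=\mu(\mathcal A\cap\mathcal B)-\mu(\mathcal A)\mu(\mathcal B)$, and for $1\le k\le n$ let $I_k(\mathcal A)=2\mu(\{x\in\mathcal A: x\oplus e_k\notin\mathcal A\})$ be the influence of the $k$-th variable, where $x\oplus e_k$ is $x$ with $x_k$ replaced by $1-x_k$. The family $\mathcal A$ is increasing if $x\in\mathcal A$ and $x_i\le y_i$ for all $i$ imply $y\in\mathcal A$; it is regular if $I_1(\mathcal A)=\dots=I_n(\mathcal A)$; and it is balanced if $\mu(\mathcal A)=1/2$. Then there is a universal constant $c>0$ such that for every $n\ge 1$, every increasing, regular and balanced family $\mathcal A\subset\Omega_n$, and the majority family $\mathcal B=\{x\in\Omega_n:\sum_{i=1}^n x_i>n/2\}$, $$\mathrm{Cov}(\mathcal A,\mathcal B)\ \ge\ c\,\frac{\sqrt{\log n}}{\sqrt n}.$$ -/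

import Mathlib

namespace DiscreteCube

/-- The discrete cube `{0,1}^n`, with the coordinatewise order (`false < true`), which is
inclusion of subsets of `[n]`. -/
abbrev Cube (n : ℕ) : Type := Fin n → Bool

/-- The uniform probability measure of a family. -/
noncomputable def mu {n : ℕ} (A : Finset (Cube n)) : ℝ := (A.card : ℝ) / 2 ^ n

/-- `x ⊕ e_k`: replace the coordinate `x k` by `1 - x k`. -/
def flip {n : ℕ} (k : Fin n) (x : Cube n) : Cube n := Function.update x k (!x k)

/-- `Cov(A,B) = μ(A ∩ B) - μ(A) μ(B)`. -/
noncomputable def cov {n : ℕ} (A B : Finset (Cube n)) : ℝ := mu (A ∩ B) - mu A * mu B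

/-- The influence `I_k(A) = 2 μ({x ∈ A | x ⊕ e_k ∉ A})`. -/
noncomputable def influence {n : ℕ} (k : Fin n) (A : Finset (Cube n)) : ℝ :=
  2 * mu (A.filter fun x => flip k x ∉ A)

/-- If `S ∈ A` and `S ⊆ T` then `T ∈ A`. -/
def IsIncreasing {n : ℕ} (A : Finset (Cube n)) : Prop := IsUpperSet (A : Set (Cube n))

/-- All influences are equal. -/
def IsRegular {n : ℕ} (A : Finset (Cube n)) : Prop :=
  ∀ i j : Fin n, influence i A = influence j A

def IsBalanced {n : ℕ} (A : Finset (Cube n)) : Prop := mu A = 1 / 2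

/-- The majority family `{x : ∑ x_i > n/2}`. -/
noncomputable def majority (n : ℕ) : Finset (Cube n) :=
  Finset.univ.filter fun x => (n : ℝ) / 2 < ∑ i, if x i then (1 : ℝ) else 0

end DiscreteCube

/-!
The Fourier side shows that a family with small influences has large total influence: feeding
the `{-1, 0, 1}`-valued differences `1_A(x) - 1_A(x ⊕ e_i)` to Bonami's inequality bounds
`∑ 4 |S| 3^{-|S|} Â(S)²` by `√(max influence) · I(A)`, while Jensen's inequality bounds it below
by `4 Var(A) 3^{-I(A) / (4 Var A)}`. For a regular family of variance `v` this gives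
`I(A) ≳ v log (n / v)`.

On the other side, averaging `1_A` over permutations of the coordinates replaces an increasing
`A` by a monotone function `q` of `T(x) = ∑ ±1`, without changing its correlation with functions
of `T`. If `a` is the value that `q` crosses where `T` crosses `0`, then
`Cov(A, majority) ≥ E|q - a| / 4` and `I(A) = 2 E|q - a||T|`. Since `|T|` exceeds a large multiple
of `√(n log (n / v))` with negligible probability, `I(A) ≲ √(n log (n / v)) · Cov(A, majority)`.
Comparing the two bounds gives `Cov(A, majority) ≳ v √(log (n / v)) / √n`.
-/

namespace DiscreteCube

open Finset BigOperators

variable {n : ℕ}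

/-! ### Expectations over the cube -/

theorem flip_involutive (k : Fin n) : Function.Involutive (flip (n := n) k) := fun x => by
  simp [flip]

theorem flip_le {k : Fin n} {x : Cube n} (h : x k = true) : flip k x ≤ x := by
  simp [flip, h]

theorem le_flip {k : Fin n} {x : Cube n} (h : x k = false) : x ≤ flip k x := by
  simp [flip, h]

theorem expect_flip (k : Fin n) (f : Cube n → ℝ) : 𝔼 x, f (flip k x) = 𝔼 x, f x :=
  Fintype.expect_equiv (flip_involutive k).toPerm _ _ fun _ => rfl

theorem expect_compl (f : Cube n → ℝ) : 𝔼 x : Cube n, f xᶜ = 𝔼 x, f x :=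
  Fintype.expect_equiv (compl_involutive (α := Cube n)).toPerm _ _ fun _ => rfl

theorem expect_comp_perm (σ : Equiv.Perm (Fin n)) (f : Cube n → ℝ) :
    𝔼 x : Cube n, f (x ∘ σ) = 𝔼 x, f x :=
  Fintype.expect_equiv (Equiv.arrowCongr σ.symm (Equiv.refl Bool)) _ _ fun _ => rfl

theorem sum_mul_pow_four_le {ι : Type*} (s : Finset ι) (f g : ι → ℝ) :
    (∑ x ∈ s, f x * g x) ^ 4 ≤ (∑ x ∈ s, |f x| ^ (4 / 3 : ℝ)) ^ 3 * ∑ x ∈ s, g x ^ 4 := by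
  set P := ∑ x ∈ s, |f x| ^ (4 / 3 : ℝ)
  set Q := ∑ x ∈ s, g x ^ 4
  have hP : 0 ≤ P := sum_nonneg fun x _ => by positivity
  have hQ : 0 ≤ Q := sum_nonneg fun x _ => by positivity
  have h_pow (x : ι) : |g x| ^ (4 : ℝ) = g x ^ 4 := by
    rw [← Nat.cast_ofNat, Real.rpow_natCast, Even.pow_abs (by decide)]
  have h_holder : |∑ x ∈ s, f x * g x| ≤ P ^ (3 / 4 : ℝ) * Q ^ (1 / 4 : ℝ) := by
    have h := Real.inner_le_Lp_mul_Lq s (fun x => |f x|) (fun x => |g x|)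
      (Real.holderConjugate_iff.2 (by norm_num) : (4 / 3 : ℝ).HolderConjugate 4)
    simp only [abs_abs, ← abs_mul, h_pow, one_div_div] at h
    exact (abs_sum_le_sum_abs _ _).trans h
  calc (∑ x ∈ s, f x * g x) ^ 4 = |∑ x ∈ s, f x * g x| ^ 4 := (Even.pow_abs (by decide) _).symm
    _ ≤ (P ^ (3 / 4 : ℝ) * Q ^ (1 / 4 : ℝ)) ^ 4 := by gcongr
    _ = P ^ 3 * Q := by
      rw [mul_pow, ← Real.rpow_mul_natCast hP, ← Real.rpow_mul_natCast hQ]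
      norm_num

theorem expect_mul_pow_four_le {ι : Type*} (s : Finset ι) (f g : ι → ℝ) :
    (𝔼 x ∈ s, f x * g x) ^ 4 ≤ (𝔼 x ∈ s, |f x| ^ (4 / 3 : ℝ)) ^ 3 * 𝔼 x ∈ s, g x ^ 4 := by
  simp only [expect_eq_sum_div_card, div_pow, div_mul_div_comm, ← pow_succ]
  gcongr
  exact sum_mul_pow_four_le s f g

/-! ### Walsh functions -/

/-- The `i`-th coordinate with values in `{-1, 1}`. -/
def sgn (i : Fin n) (x : Cube n) : ℝ := if x i then 1 else -1

theorem sgn_flip_same (i : Fin n) (x : Cube n) : sgn i (flip i x) = -sgn i x := by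
  cases h : x i <;> simp [sgn, flip, h]

theorem sgn_flip_of_ne {i k : Fin n} (h : i ≠ k) (x : Cube n) : sgn i (flip k x) = sgn i x := by
  simp [sgn, flip, h]

theorem sgn_compl (i : Fin n) (x : Cube n) : sgn i xᶜ = -sgn i x := by
  cases h : x i <;> simp [sgn, h]

theorem abs_sgn (i : Fin n) (x : Cube n) : |sgn i x| = 1 := by
  cases h : x i <;> simp [sgn, h]

theorem sgn_sq (i : Fin n) (x : Cube n) : sgn i x ^ 2 = 1 := by
  rw [← sq_abs, abs_sgn, one_pow]

/-- The Walsh function (character of the cube) of a set of coordinates. -/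
def walsh (S : Finset (Fin n)) (x : Cube n) : ℝ := ∏ i ∈ S, sgn i x

theorem walsh_insert {i : Fin n} {S : Finset (Fin n)} (h : i ∉ S) (x : Cube n) :
    walsh (insert i S) x = sgn i x * walsh S x := prod_insert h

theorem walsh_flip_of_notMem {i : Fin n} {S : Finset (Fin n)} (h : i ∉ S) (x : Cube n) :
    walsh S (flip i x) = walsh S x :=
  prod_congr rfl fun _ hj => sgn_flip_of_ne (ne_of_mem_of_not_mem hj h) x

theorem walsh_flip_of_mem {i : Fin n} {S : Finset (Fin n)} (h : i ∈ S) (x : Cube n) :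
    walsh S (flip i x) = -walsh S x := by
  rw [← insert_erase h, walsh_insert (notMem_erase i S), walsh_insert (notMem_erase i S),
    sgn_flip_same, walsh_flip_of_notMem (notMem_erase i S), neg_mul]

theorem sum_walsh_mul_walsh (x y : Cube n) :
    ∑ S, walsh S x * walsh S y = if x = y then (2 : ℝ) ^ n else 0 := by
  have h_prod : ∑ S, walsh S x * walsh S y = ∏ i : Fin n, (1 + sgn i x * sgn i y) := by
    simp only [prod_one_add, powerset_univ, walsh, prod_mul_distrib]
  rw [h_prod]
  split_ifs with hxy
  · subst hxy
    simp only [← sq, sgn_sq]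
    norm_num
  · obtain ⟨i, hi⟩ := Function.ne_iff.1 hxy
    refine prod_eq_zero (mem_univ i) ?_
    cases hx : x i <;> cases hy : y i <;> simp_all [sgn]

/-- The Fourier–Walsh coefficients of a function on the cube. -/
noncomputable def walshCoeff (f : Cube n → ℝ) (S : Finset (Fin n)) : ℝ := 𝔼 x, f x * walsh S x

theorem sum_walshCoeff_mul_walsh (f : Cube n → ℝ) (x : Cube n) :
    ∑ S, walshCoeff f S * walsh S x = f x := by
  simp only [walshCoeff, expect_mul, mul_assoc]
  rw [← expect_sum_comm]
  simp only [← mul_sum, sum_walsh_mul_walsh]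
  rw [Fintype.expect_eq_sum_div_card]
  simp

theorem expect_mul_sum_walsh (f : Cube n → ℝ) (a : Finset (Fin n) → ℝ) :
    𝔼 x, f x * ∑ S, a S * walsh S x = ∑ S, a S * walshCoeff f S := by
  simp only [mul_sum, walshCoeff, mul_expect]
  rw [expect_sum_comm]
  exact sum_congr rfl fun S _ => expect_congr rfl fun x _ => mul_left_comm _ _ _

/-- The noise stability `Stab_ρ(f) = ∑ ρ^|S| f̂(S)²`, which is `E[f(x) f(y)]` for `ρ`-correlated
uniform points `x` and `y` of the cube. -/
noncomputable def noiseStability (ρ : ℝ) (f : Cube n → ℝ) : ℝ :=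
  ∑ S, ρ ^ #S * walshCoeff f S ^ 2

theorem noiseStability_one (f : Cube n → ℝ) : noiseStability 1 f = 𝔼 x, f x ^ 2 := by
  simp only [noiseStability, one_pow, one_mul, sq, ← expect_mul_sum_walsh,
    sum_walshCoeff_mul_walsh]

/-! ### Hypercontractivity -/

theorem expect_add_sgn_mul_pow_four {i : Fin n} {g h : Cube n → ℝ}
    (hg : ∀ x, g (flip i x) = g x) (hh : ∀ x, h (flip i x) = h x) :
    𝔼 x, (g x + sgn i x * h x) ^ 4
      = 𝔼 x, g x ^ 4 + 6 * 𝔼 x, g x ^ 2 * h x ^ 2 + 𝔼 x, h x ^ 4 := by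
  have h_flip := expect_flip i fun x => (g x + sgn i x * h x) ^ 4
  simp only [hg, hh, sgn_flip_same] at h_flip
  have h_sum : 𝔼 x, (g x + -sgn i x * h x) ^ 4 + 𝔼 x, (g x + sgn i x * h x) ^ 4
      = 2 * (𝔼 x, g x ^ 4 + 6 * 𝔼 x, g x ^ 2 * h x ^ 2 + 𝔼 x, h x ^ 4) := by
    simp only [mul_expect, ← expect_add_distrib]
    refine expect_congr rfl fun x _ => ?_
    linear_combination
      (12 * g x ^ 2 * h x ^ 2 + 2 * h x ^ 4 * (sgn i x ^ 2 + 1)) * sgn_sq i x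
  linarith

theorem expect_sq_mul_sq_le {ι : Type*} {s : Finset ι} {g h : ι → ℝ} {a b : ℝ} (ha : 0 ≤ a)
    (hb : 0 ≤ b) (hg : 𝔼 x ∈ s, g x ^ 4 ≤ a ^ 2) (hh : 𝔼 x ∈ s, h x ^ 4 ≤ b ^ 2) :
    𝔼 x ∈ s, g x ^ 2 * h x ^ 2 ≤ a * b := by
  refine le_of_sq_le_sq ?_ (mul_nonneg ha hb)
  calc (𝔼 x ∈ s, g x ^ 2 * h x ^ 2) ^ 2
      ≤ (𝔼 x ∈ s, (g x ^ 2) ^ 2) * 𝔼 x ∈ s, (h x ^ 2) ^ 2 := expect_mul_sq_le_sq_mul_sq _ _ _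
    _ = (𝔼 x ∈ s, g x ^ 4) * 𝔼 x ∈ s, h x ^ 4 := by simp only [← pow_mul, Nat.reduceMul]
    _ ≤ a ^ 2 * b ^ 2 :=
      mul_le_mul hg hh (expect_nonneg fun x _ => by positivity) (sq_nonneg a)
    _ = (a * b) ^ 2 := (mul_pow a b 2).symm

theorem expect_add_sgn_mul_pow_four_le {i : Fin n} {g h : Cube n → ℝ} {a b : ℝ} (ha : 0 ≤ a)
    (hb : 0 ≤ b) (hg : ∀ x, g (flip i x) = g x) (hh : ∀ x, h (flip i x) = h x)
    (hga : 𝔼 x, g x ^ 4 ≤ a ^ 2) (hhb : 𝔼 x, h x ^ 4 ≤ b ^ 2) :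
    𝔼 x, (g x + sgn i x * h x) ^ 4 ≤ (a + 3 * b) ^ 2 := by
  rw [expect_add_sgn_mul_pow_four hg hh]
  have h_cross := expect_sq_mul_sq_le ha hb hga hhb
  linarith [sq_nonneg b, add_sq a (3 * b), mul_pow 3 b 2]

theorem expect_sum_walsh_pow_four_le (U : Finset (Fin n)) (a : Finset (Fin n) → ℝ) :
    𝔼 x, (∑ S ∈ U.powerset, a S * walsh S x) ^ 4
      ≤ (∑ S ∈ U.powerset, 3 ^ #S * a S ^ 2) ^ 2 := by
  induction U using Finset.induction_on generalizing a with
  | empty =>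
    simp only [powerset_empty, sum_singleton, walsh, prod_empty, card_empty,
      Fintype.expect_const]
    exact le_of_eq (by ring)
  | insert i U hi ih =>
    have notMem {S} (hS : S ∈ U.powerset) : i ∉ S := fun hiS => hi (mem_powerset.1 hS hiS)
    have h_walsh (x : Cube n) : ∑ S ∈ (insert i U).powerset, a S * walsh S x
        = ∑ S ∈ U.powerset, a S * walsh S x
          + sgn i x * ∑ S ∈ U.powerset, a (insert i S) * walsh S x := by
      rw [sum_powerset_insert hi, mul_sum]
      congr 1
      refine sum_congr rfl fun S hS => ?_
      rw [walsh_insert (notMem hS), mul_left_comm]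
    have h_sq : ∑ S ∈ (insert i U).powerset, 3 ^ #S * a S ^ 2
        = ∑ S ∈ U.powerset, 3 ^ #S * a S ^ 2
          + 3 * ∑ S ∈ U.powerset, 3 ^ #S * a (insert i S) ^ 2 := by
      rw [sum_powerset_insert hi, mul_sum]
      congr 1
      refine sum_congr rfl fun S hS => ?_
      rw [card_insert_of_notMem (notMem hS), pow_succ', mul_assoc]
    have h_flip (b : Finset (Fin n) → ℝ) (x : Cube n) :
        ∑ S ∈ U.powerset, b S * walsh S (flip i x) = ∑ S ∈ U.powerset, b S * walsh S x :=
      sum_congr rfl fun S hS => by rw [walsh_flip_of_notMem (notMem hS)]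
    simp only [h_walsh, h_sq]
    exact expect_add_sgn_mul_pow_four_le (sum_nonneg fun S _ => by positivity)
      (sum_nonneg fun S _ => by positivity) (h_flip a) (h_flip _) (ih a) (ih _)

theorem noiseStability_one_third_sq_le (f : Cube n → ℝ) :
    noiseStability (1 / 3) f ^ 2 ≤ (𝔼 x, |f x| ^ (4 / 3 : ℝ)) ^ 3 := by
  set W := noiseStability (1 / 3) f
  set P := 𝔼 x, |f x| ^ (4 / 3 : ℝ)
  set F : Cube n → ℝ := fun x => ∑ S, (1 / 3) ^ #S * walshCoeff f S * walsh S x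
  -- Duality: `F` is a smoothing of `f` whose fourth moment Bonami's inequality bounds by `W²`.
  have h_pairing : W = 𝔼 x, f x * F x := by
    rw [expect_mul_sum_walsh]
    exact sum_congr rfl fun S _ => by ring
  have h_bonami : 𝔼 x, F x ^ 4 ≤ W ^ 2 := by
    have h := expect_sum_walsh_pow_four_le univ fun S => (1 / 3) ^ #S * walshCoeff f S
    rw [powerset_univ] at h
    refine h.trans_eq (congrArg (· ^ 2) (sum_congr rfl fun S _ => ?_))
    rw [mul_pow, sq ((1 / 3 : ℝ) ^ #S), ← mul_assoc, ← mul_assoc, ← mul_pow]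
    norm_num
  have hP : 0 ≤ P := expect_nonneg fun x _ => by positivity
  have h_fourth : W ^ 2 * W ^ 2 ≤ P ^ 3 * W ^ 2 := by
    calc W ^ 2 * W ^ 2 = (𝔼 x, f x * F x) ^ 4 := by rw [← h_pairing]; ring
      _ ≤ P ^ 3 * 𝔼 x, F x ^ 4 := expect_mul_pow_four_le _ _ _
      _ ≤ P ^ 3 * W ^ 2 := by gcongr
  rcases (sq_nonneg W).eq_or_lt with hW | hW
  · exact hW ▸ pow_nonneg hP 3
  · exact le_of_mul_le_mul_right h_fourth hW

/-! ### Influences -/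

/-- The difference `f(x) - f(x ⊕ e_i)` of a function in the `i`-th direction. -/
def flipDiff (i : Fin n) (f : Cube n → ℝ) (x : Cube n) : ℝ := f x - f (flip i x)

theorem walshCoeff_flipDiff (i : Fin n) (f : Cube n → ℝ) (S : Finset (Fin n)) :
    walshCoeff (flipDiff i f) S = if i ∈ S then 2 * walshCoeff f S else 0 := by
  have h_flip := expect_flip i fun x => f x * walsh S (flip i x)
  simp only [flip_involutive i _] at h_flip
  simp only [walshCoeff, flipDiff, sub_mul, expect_sub_distrib, h_flip]
  split_ifs with hi
  · simp only [walsh_flip_of_mem hi, mul_neg, expect_neg_distrib]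
    ring
  · simp only [walsh_flip_of_notMem hi, sub_self]

theorem sum_noiseStability_flipDiff (ρ : ℝ) (f : Cube n → ℝ) :
    ∑ i, noiseStability ρ (flipDiff i f) = ∑ S, 4 * #S * (ρ ^ #S * walshCoeff f S ^ 2) := by
  simp only [noiseStability]
  rw [sum_comm]
  refine sum_congr rfl fun S _ => ?_
  have h_term (i : Fin n) : ρ ^ #S * walshCoeff (flipDiff i f) S ^ 2
      = if i ∈ S then 4 * (ρ ^ #S * walshCoeff f S ^ 2) else 0 := by
    rw [walshCoeff_flipDiff]
    split_ifs <;> ring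
  simp only [h_term, sum_ite_mem, univ_inter, sum_const, nsmul_eq_mul]
  ring

/-- The indicator function of a family. -/
def ind (A : Finset (Cube n)) (x : Cube n) : ℝ := if x ∈ A then 1 else 0

theorem ind_mem_Icc (A : Finset (Cube n)) (x : Cube n) : ind A x ∈ Set.Icc (0 : ℝ) 1 := by
  by_cases h : x ∈ A <;> simp [ind, h]

theorem ind_sq (A : Finset (Cube n)) (x : Cube n) : ind A x ^ 2 = ind A x := by
  by_cases h : x ∈ A <;> simp [ind, h]

theorem ind_inter (A B : Finset (Cube n)) (x : Cube n) :
    ind (A ∩ B) x = ind A x * ind B x := by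
  by_cases hA : x ∈ A <;> by_cases hB : x ∈ B <;> simp [ind, hA, hB]

theorem IsIncreasing.monotone_ind {A : Finset (Cube n)} (hA : IsIncreasing A) :
    Monotone (ind A) := fun x y hxy => by
  by_cases hx : x ∈ A
  · have hy : y ∈ A := hA hxy hx
    simp [ind, hx, hy]
  · simpa [ind, hx] using (ind_mem_Icc A y).1

theorem mu_eq_expect_ind (A : Finset (Cube n)) : mu A = 𝔼 x, ind A x := by
  simp [Fintype.expect_eq_sum_div_card, mu, ind]

theorem abs_flipDiff_ind_eq_zero_or_one (A : Finset (Cube n)) (i : Fin n) (x : Cube n) :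
    |flipDiff i (ind A) x| = 0 ∨ |flipDiff i (ind A) x| = 1 := by
  by_cases hx : x ∈ A <;> by_cases hfx : flip i x ∈ A <;> simp [flipDiff, ind, hx, hfx]

theorem influence_eq_expect_flipDiff_sq (A : Finset (Cube n)) (i : Fin n) :
    influence i A = 𝔼 x, flipDiff i (ind A) x ^ 2 := by
  set B := A.filter fun x => flip i x ∉ A
  have h_split (x : Cube n) : flipDiff i (ind A) x ^ 2 = ind B x + ind B (flip i x) := by
    simp only [B, flipDiff, ind, mem_filter, flip_involutive i x]
    by_cases hx : x ∈ A <;> by_cases hfx : flip i x ∈ A <;> simp [hx, hfx]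
  simp only [h_split, expect_add_distrib, expect_flip, ← mu_eq_expect_ind, influence, B, two_mul]

theorem influence_nonneg (A : Finset (Cube n)) (i : Fin n) : 0 ≤ influence i A := by
  rw [influence_eq_expect_flipDiff_sq]
  exact expect_nonneg fun x _ => sq_nonneg _

theorem sum_influence_eq_sum_walshCoeff_sq (A : Finset (Cube n)) :
    ∑ i, influence i A = ∑ S, 4 * #S * walshCoeff (ind A) S ^ 2 := by
  simp only [influence_eq_expect_flipDiff_sq, ← noiseStability_one, sum_noiseStability_flipDiff,
    one_pow, one_mul]

theorem noiseStability_flipDiff_ind_sq_le (A : Finset (Cube n)) (i : Fin n) :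
    noiseStability (1 / 3) (flipDiff i (ind A)) ^ 2 ≤ influence i A ^ 3 := by
  refine (noiseStability_one_third_sq_le _).trans_eq ?_
  rw [influence_eq_expect_flipDiff_sq]
  congr 1
  refine expect_congr rfl fun x _ => ?_
  rw [← sq_abs]
  rcases abs_flipDiff_ind_eq_zero_or_one A i x with h | h <;> rw [h] <;> norm_num

theorem cov_self (A : Finset (Cube n)) : cov A A = mu A * (1 - mu A) := by
  rw [cov, inter_self, mul_one_sub]

theorem cov_self_eq_sum_walshCoeff_sq (A : Finset (Cube n)) :
    cov A A = ∑ S ∈ univ.erase ∅, walshCoeff (ind A) S ^ 2 := by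
  have h_empty : walshCoeff (ind A) ∅ = mu A := by simp [walshCoeff, walsh, mu_eq_expect_ind]
  have h_total : ∑ S, walshCoeff (ind A) S ^ 2 = mu A := by
    simpa only [noiseStability, one_pow, one_mul, ind_sq, ← mu_eq_expect_ind]
      using noiseStability_one (ind A)
  rw [← add_sum_erase _ _ (mem_univ ∅), h_empty] at h_total
  rw [cov_self]
  linarith

theorem IsBalanced.cov_self {A : Finset (Cube n)} (hA : IsBalanced A) : cov A A = 1 / 4 := by
  rw [DiscreteCube.cov_self, show mu A = 1 / 2 from hA]
  norm_num

theorem cov_self_nonneg (A : Finset (Cube n)) : 0 ≤ cov A A := by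
  rw [cov_self_eq_sum_walshCoeff_sq]
  positivity

theorem cov_self_le_one_quarter (A : Finset (Cube n)) : cov A A ≤ 1 / 4 := by
  rw [cov_self]
  linarith [sq_nonneg (mu A - 1 / 2)]

theorem one_le_card_of_mem_erase_empty {S : Finset (Fin n)} (hS : S ∈ univ.erase ∅) :
    (1 : ℝ) ≤ #S :=
  Nat.one_le_cast.2 (card_pos.2 (nonempty_iff_ne_empty.2 (ne_of_mem_erase hS)))

theorem four_mul_cov_self_le_sum_influence (A : Finset (Cube n)) :
    4 * cov A A ≤ ∑ i, influence i A := by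
  rw [cov_self_eq_sum_walshCoeff_sq, sum_influence_eq_sum_walshCoeff_sq, mul_sum]
  calc ∑ S ∈ univ.erase ∅, 4 * walshCoeff (ind A) S ^ 2
      ≤ ∑ S ∈ univ.erase ∅, 4 * #S * walshCoeff (ind A) S ^ 2 := by
        gcongr with S hS
        exact le_mul_of_one_le_right (by norm_num) (one_le_card_of_mem_erase_empty hS)
    _ ≤ ∑ S, 4 * #S * walshCoeff (ind A) S ^ 2 :=
      sum_le_sum_of_subset_of_nonneg (erase_subset _ _) fun S _ _ => by positivity

/-! ### The Kahn–Kalai–Linial inequality -/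

theorem sum_mul_exp_div_sum_le {ι : Type*} {s : Finset ι} {w : ι → ℝ} (y : ι → ℝ)
    (hw : ∀ i ∈ s, 0 ≤ w i) (hpos : 0 < ∑ i ∈ s, w i) :
    (∑ i ∈ s, w i) * Real.exp ((∑ i ∈ s, w i * y i) / ∑ i ∈ s, w i)
      ≤ ∑ i ∈ s, w i * Real.exp (y i) := by
  have h := convexOn_exp.map_centerMass_le (p := y) hw hpos fun _ _ => Set.mem_univ _
  simp only [centerMass, smul_eq_mul, Function.comp_apply] at h
  rwa [← div_eq_inv_mul, ← div_eq_inv_mul, le_div_iff₀' hpos] at h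

theorem four_mul_cov_self_mul_exp_le {A : Finset (Cube n)} (hA : 0 < cov A A) :
    4 * cov A A * Real.exp (-(Real.log 3 * ((∑ i, influence i A) / (4 * cov A A))))
      ≤ ∑ i, noiseStability (1 / 3) (flipDiff i (ind A)) := by
  set w : Finset (Fin n) → ℝ := fun S => walshCoeff (ind A) S ^ 2
  have hv : cov A A = ∑ S ∈ univ.erase ∅, w S := cov_self_eq_sum_walshCoeff_sq A
  have h_mean : -(Real.log 3 * ((∑ i, influence i A) / (4 * cov A A)))
      = (∑ S ∈ univ.erase ∅, w S * -(Real.log 3 * #S)) / ∑ S ∈ univ.erase ∅, w S := by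
    rw [← hv, sum_influence_eq_sum_walshCoeff_sq, ← add_sum_erase _ _ (mem_univ ∅), card_empty,
      eq_div_iff hA.ne', Nat.cast_zero, mul_zero, zero_mul, zero_add, sum_div, mul_sum,
      ← sum_neg_distrib, sum_mul]
    refine sum_congr rfl fun S _ => ?_
    simp only [w]
    field_simp
  have h_exp (S : Finset (Fin n)) : Real.exp (-(Real.log 3 * #S)) = (1 / 3) ^ #S := by
    rw [mul_comm, ← mul_neg, Real.exp_nat_mul, Real.exp_neg, Real.exp_log (by norm_num), one_div]
  have h_jensen := sum_mul_exp_div_sum_le (w := w) (fun S => -(Real.log 3 * #S))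
    (fun S _ => sq_nonneg _) (hv ▸ hA)
  rw [← h_mean, ← hv] at h_jensen
  rw [sum_noiseStability_flipDiff, mul_assoc]
  calc 4 * (cov A A * Real.exp (-(Real.log 3 * ((∑ i, influence i A) / (4 * cov A A)))))
      ≤ 4 * ∑ S ∈ univ.erase ∅, w S * Real.exp (-(Real.log 3 * #S)) := by gcongr
    _ = ∑ S ∈ univ.erase ∅, 4 * 1 * ((1 / 3) ^ #S * w S) := by
      simp only [h_exp, mul_sum, mul_one, mul_comm (w _)]
    _ ≤ ∑ S ∈ univ.erase ∅, 4 * #S * ((1 / 3) ^ #S * w S) := by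
      gcongr with S hS
      exact one_le_card_of_mem_erase_empty hS
    _ ≤ ∑ S, 4 * #S * ((1 / 3) ^ #S * w S) :=
      sum_le_sum_of_subset_of_nonneg (erase_subset _ _) fun S _ _ =>
        mul_nonneg (by positivity) (mul_nonneg (by positivity) (sq_nonneg _))

theorem sum_noiseStability_flipDiff_ind_le {A : Finset (Cube n)} {δ : ℝ}
    (hδ : ∀ i, influence i A ≤ δ) :
    ∑ i, noiseStability (1 / 3) (flipDiff i (ind A)) ≤ √δ * ∑ i, influence i A := by
  rw [mul_sum]
  refine sum_le_sum fun i _ => ?_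
  have hI := influence_nonneg A i
  refine le_of_sq_le_sq ?_ (by positivity)
  calc noiseStability (1 / 3) (flipDiff i (ind A)) ^ 2 ≤ influence i A * influence i A ^ 2 :=
        (noiseStability_flipDiff_ind_sq_le A i).trans_eq (pow_succ' _ 2)
    _ ≤ δ * influence i A ^ 2 := by gcongr; exact hδ i
    _ = (√δ * influence i A) ^ 2 := by rw [mul_pow, Real.sq_sqrt (hI.trans (hδ i))]

theorem log_inv_le_of_exp_le_sqrt_mul {δ r : ℝ} (hδ : 0 < δ) (hr : 0 < r)
    (h : Real.exp (-(Real.log 3 * r)) ≤ √δ * r) : Real.log δ⁻¹ ≤ 6 * r := by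
  have h_log := Real.log_le_log (Real.exp_pos _) h
  rw [Real.log_exp, Real.log_mul (by positivity) hr.ne', Real.log_sqrt hδ.le] at h_log
  have h_log_three : Real.log 3 ≤ 2 :=
    (Real.log_le_sub_one_of_pos (by norm_num)).trans_eq (by norm_num)
  rw [Real.log_inv]
  linarith [Real.log_le_sub_one_of_pos hr, mul_le_mul_of_nonneg_right h_log_three hr.le]

theorem cov_self_mul_log_inv_le {A : Finset (Cube n)} {δ : ℝ} (hδ : ∀ i, influence i A ≤ δ) :
    cov A A * Real.log δ⁻¹ ≤ 3 / 2 * ∑ i, influence i A := by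
  set v := cov A A
  set K := ∑ i, influence i A
  have h_poincare : 4 * v ≤ K := four_mul_cov_self_le_sum_influence A
  rcases (cov_self_nonneg A).eq_or_lt with hv | (hv : 0 < v)
  · simpa [v, ← hv] using sum_nonneg fun i _ => influence_nonneg A i
  have hv4 : 0 < 4 * v := mul_pos four_pos hv
  have hK : 0 < K := hv4.trans_le h_poincare
  obtain ⟨i, hi⟩ : ∃ i, 0 < influence i A := by
    by_contra! h
    exact hK.not_ge (sum_nonpos fun i _ => h i)
  have hr : 0 < K / (4 * v) := div_pos hK hv4
  have h_exp : Real.exp (-(Real.log 3 * (K / (4 * v)))) ≤ √δ * (K / (4 * v)) := by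
    rw [← mul_div_assoc √δ, le_div_iff₀' hv4]
    exact (four_mul_cov_self_mul_exp_le hv).trans (sum_noiseStability_flipDiff_ind_le hδ)
  calc v * Real.log δ⁻¹ ≤ v * (6 * (K / (4 * v))) := by
        gcongr
        exact log_inv_le_of_exp_le_sqrt_mul (hi.trans_le (hδ i)) hr h_exp
    _ = 3 / 2 * K := by
      field_simp
      norm_num

theorem IsRegular.cov_self_mul_log_le {A : Finset (Cube n)} (hA : IsRegular A) :
    cov A A * Real.log (n / cov A A) ≤ 5 / 2 * ∑ i, influence i A := by
  set v := cov A A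
  set K := ∑ i, influence i A
  have h_poincare : 4 * v ≤ K := four_mul_cov_self_le_sum_influence A
  rcases (cov_self_nonneg A).eq_or_lt with hv | hv
  · simpa [v, ← hv] using sum_nonneg fun i _ => influence_nonneg A i
  have hK : 0 < K := by linarith
  rcases Nat.eq_zero_or_pos n with rfl | hn
  · simp [K] at hK
  have h_influence (i : Fin n) : influence i A ≤ K / n := by
    rw [le_div_iff₀' (by positivity)]
    simp [K, fun j => hA j i]
  have h_kkl := cov_self_mul_log_inv_le h_influence
  have h_log : Real.log (n / v) = Real.log (K / n)⁻¹ + Real.log (K / v) := by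
    rw [← Real.log_mul (by positivity) (by positivity)]
    congr 1
    field_simp
  calc v * Real.log (n / v) = v * Real.log (K / n)⁻¹ + v * Real.log (K / v) := by
        rw [h_log, mul_add]
    _ ≤ 3 / 2 * K + v * (K / v) := by
      gcongr
      exact Real.log_le_self (by positivity)
    _ = 5 / 2 * K := by
      rw [mul_div_cancel₀ _ hv.ne']
      ring

/-! ### The sum of the coordinates -/

/-- The sum of the `±1`-valued coordinates; the majority family is where it is positive. -/
def signSum (x : Cube n) : ℝ := ∑ i, sgn i x

theorem signSum_eq_card (x : Cube n) : signSum x = 2 * #{i | x i = true} - n := by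
  have h_sgn (i : Fin n) : sgn i x = 2 * (if x i = true then 1 else 0) - 1 := by
    cases h : x i <;> norm_num [sgn, h]
  simp only [signSum, h_sgn, sum_sub_distrib, ← mul_sum, sum_boole, sum_const, card_univ,
    Fintype.card_fin, nsmul_eq_mul, mul_one]

theorem mem_majority (x : Cube n) : x ∈ majority n ↔ 0 < signSum x := by
  rw [signSum_eq_card]
  simp only [majority, mem_filter, mem_univ, true_and, sum_boole]
  constructor <;> intro h <;> linarith

theorem signSum_comp_perm (σ : Equiv.Perm (Fin n)) (x : Cube n) :
    signSum (x ∘ σ) = signSum x :=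
  Equiv.sum_comp σ fun i => sgn i x

theorem signSum_compl (x : Cube n) : signSum xᶜ = -signSum x := by
  simp only [signSum, sgn_compl, sum_neg_distrib]

theorem signSum_flip (i : Fin n) (x : Cube n) : signSum (flip i x) = signSum x - 2 * sgn i x := by
  rw [signSum, signSum, ← add_sum_erase _ _ (mem_univ i), ← add_sum_erase _ _ (mem_univ i),
    sgn_flip_same, sum_congr rfl fun j hj => sgn_flip_of_ne (ne_of_mem_erase hj) x]
  ring

theorem abs_signSum_le (x : Cube n) : |signSum x| ≤ n := by
  simpa only [signSum, abs_sgn, sum_const, card_univ, Fintype.card_fin, nsmul_one]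
    using abs_sum_le_sum_abs (fun i => sgn i x) univ

theorem expect_signSum : 𝔼 x : Cube n, signSum x = 0 := by
  have h := expect_compl (signSum (n := n))
  simp only [signSum_compl, expect_neg_distrib] at h
  linarith

theorem IsIncreasing.influence_eq_two_mul_walshCoeff {A : Finset (Cube n)} (hA : IsIncreasing A)
    (i : Fin n) : influence i A = 2 * walshCoeff (ind A) {i} := by
  have h_coeff := walshCoeff_flipDiff i (ind A) {i}
  rw [if_pos (mem_singleton_self i)] at h_coeff
  rw [← h_coeff, influence_eq_expect_flipDiff_sq]
  refine expect_congr rfl fun x _ => ?_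
  rw [walsh, prod_singleton, ← sq_abs]
  have h_sq : |flipDiff i (ind A) x| ^ 2 = |flipDiff i (ind A) x| := by
    rcases abs_flipDiff_ind_eq_zero_or_one A i x with h | h <;> norm_num [h]
  rw [h_sq]
  cases hx : x i
  · have h_nonpos : flipDiff i (ind A) x ≤ 0 := sub_nonpos.2 (hA.monotone_ind (le_flip hx))
    simp [sgn, hx, abs_of_nonpos h_nonpos]
  · have h_nonneg : 0 ≤ flipDiff i (ind A) x := sub_nonneg.2 (hA.monotone_ind (flip_le hx))
    simp [sgn, hx, abs_of_nonneg h_nonneg]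

theorem IsIncreasing.sum_influence_eq_two_mul_expect {A : Finset (Cube n)}
    (hA : IsIncreasing A) : ∑ i, influence i A = 2 * 𝔼 x, ind A x * signSum x := by
  simp only [hA.influence_eq_two_mul_walshCoeff, ← mul_sum, walshCoeff, walsh, prod_singleton]
  rw [← expect_sum_comm]
  simp only [← mul_sum, signSum]

theorem mu_majority_le_one_half : mu (majority n) ≤ 1 / 2 := by
  have h_disjoint (x : Cube n) : ind (majority n) x + ind (majority n) xᶜ ≤ 1 := by
    simp only [ind, mem_majority, signSum_compl]
    split_ifs <;> linarith
  have h := expect_le univ_nonempty fun x _ => h_disjoint x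
  rw [expect_add_distrib, expect_compl, ← mu_eq_expect_ind] at h
  linarith

/-- One of `x`, `xᶜ`, `x ⊕ e_i`, `(x ⊕ e_i)ᶜ` has a strict majority, because flipping a coordinate
breaks a tie. -/
theorem one_quarter_le_mu_majority (hn : 0 < n) : 1 / 4 ≤ mu (majority n) := by
  set B := ind (majority n)
  let i : Fin n := ⟨0, hn⟩
  have h_cover (x : Cube n) : 1 ≤ B x + B xᶜ + (B (flip i x) + B (flip i x)ᶜ) := by
    simp only [B, ind, mem_majority, signSum_compl, signSum_flip]
    rcases eq_or_ne (x i) true with hx | hx <;> simp only [sgn, hx] <;> split_ifs <;> grind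
  have h := le_expect univ_nonempty fun x _ => h_cover x
  rw [expect_add_distrib, expect_flip i fun x => B x + B xᶜ, expect_add_distrib, expect_compl,
    ← mu_eq_expect_ind] at h
  linarith

/-! ### Concentration -/

theorem expect_exp_mul_signSum (t : ℝ) :
    𝔼 x : Cube n, Real.exp (t * signSum x) = Real.cosh t ^ n := by
  let φ : Bool → ℝ := fun b => Real.exp (t * if b then 1 else -1)
  have h_prod (x : Cube n) : Real.exp (t * signSum x) = ∏ i, φ (x i) := by
    rw [signSum, mul_sum, Real.exp_sum]
    rfl
  simp only [h_prod, Fintype.expect_eq_sum_div_card]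
  rw [← Fintype.prod_sum fun (_ : Fin n) => φ]
  simp [φ, Real.cosh_eq, div_pow]

theorem mu_lt_signSum_le {M : ℝ} (hM : 0 ≤ M) :
    mu ({x | M < signSum x} : Finset (Cube n)) ≤ Real.exp (-(M ^ 2 / (2 * n))) := by
  set t := M / n
  have ht : 0 ≤ t := by positivity
  have h_markov (x : Cube n) : ind ({x | M < signSum x} : Finset (Cube n)) x
      ≤ Real.exp (-(t * M)) * Real.exp (t * signSum x) := by
    rw [← Real.exp_add]
    by_cases hx : M < signSum x
    · simpa [ind, hx] using mul_le_mul_of_nonneg_left hx.le ht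
    · simpa [ind, hx] using (Real.exp_pos _).le
  calc mu ({x | M < signSum x} : Finset (Cube n))
      ≤ 𝔼 x : Cube n, Real.exp (-(t * M)) * Real.exp (t * signSum x) := by
        rw [mu_eq_expect_ind]
        exact expect_le_expect fun x _ => h_markov x
    _ = Real.exp (-(t * M)) * Real.cosh t ^ n := by rw [← mul_expect, expect_exp_mul_signSum]
    _ ≤ Real.exp (-(t * M)) * Real.exp (t ^ 2 / 2) ^ n := by
      gcongr
      exact Real.cosh_le_exp_half_sq t
    _ = Real.exp (-(M ^ 2 / (2 * n))) := by
      rw [← Real.exp_nat_mul, ← Real.exp_add]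
      rcases Nat.eq_zero_or_pos n with rfl | hn
      · simp [t]
      · congr 1
        simp only [t]
        field_simp
        ring

theorem mu_lt_abs_signSum_le {M : ℝ} (hM : 0 ≤ M) :
    mu ({x | M < |signSum x|} : Finset (Cube n)) ≤ 2 * Real.exp (-(M ^ 2 / (2 * n))) := by
  set U : Finset (Cube n) := {x | M < signSum x}
  have h_union (x : Cube n) :
      ind ({x | M < |signSum x|} : Finset (Cube n)) x ≤ ind U x + ind U xᶜ := by
    simp only [U, ind, mem_filter, mem_univ, true_and, signSum_compl, lt_abs]
    split_ifs <;> grind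
  have h := expect_le_expect (s := univ) fun x _ => h_union x
  rw [expect_add_distrib, expect_compl, ← mu_eq_expect_ind, ← mu_eq_expect_ind] at h
  linarith [mu_lt_signSum_le (n := n) hM]

theorem expect_mul_abs_signSum_le {g : Cube n → ℝ} (hg : ∀ x, g x ∈ Set.Icc (0 : ℝ) 1) {M : ℝ}
    (hM : 0 ≤ M) :
    𝔼 x, g x * |signSum x| ≤ M * 𝔼 x, g x + 2 * n * Real.exp (-(M ^ 2 / (2 * n))) := by
  set V : Finset (Cube n) := {x | M < |signSum x|}
  have h_truncate (x : Cube n) : g x * |signSum x| ≤ M * g x + n * ind V x := by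
    obtain ⟨hg0, hg1⟩ := hg x
    by_cases hx : M < |signSum x|
    · have h_le : g x * |signSum x| ≤ 1 * n :=
        mul_le_mul hg1 (abs_signSum_le x) (abs_nonneg _) zero_le_one
      simpa [V, ind, hx] using h_le.trans (by linarith [mul_nonneg hM hg0])
    · simpa [V, ind, hx, mul_comm M] using mul_le_mul_of_nonneg_left (not_lt.1 hx) hg0
  calc 𝔼 x, g x * |signSum x| ≤ 𝔼 x, (M * g x + n * ind V x) :=
        expect_le_expect fun x _ => h_truncate x
    _ = M * 𝔼 x, g x + n * mu V := by
      rw [expect_add_distrib, ← mul_expect, ← mul_expect, ← mu_eq_expect_ind]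
    _ ≤ M * 𝔼 x, g x + n * (2 * Real.exp (-(M ^ 2 / (2 * n)))) := by
      gcongr
      exact mu_lt_abs_signSum_le hM
    _ = M * 𝔼 x, g x + 2 * n * Real.exp (-(M ^ 2 / (2 * n))) := by ring

/-! ### Symmetrization -/

theorem exists_perm_comp_le {x y : Cube n} (h : signSum x ≤ signSum y) :
    ∃ σ : Equiv.Perm (Fin n), x ∘ σ ≤ y := by
  rw [signSum_eq_card, signSum_eq_card] at h
  have h_card : #{i | x i = true} ≤ #{i | y i = true} :=
    Nat.cast_le.1 (by linarith : (#{i | x i = true} : ℝ) ≤ #{i | y i = true})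
  obtain ⟨t, ht, ht_card⟩ := exists_subset_card_eq h_card
  let e : {i // i ∈ t} ≃ {i // x i = true} :=
    Fintype.equivOfCardEq (by rw [Fintype.card_coe, ht_card, Fintype.card_subtype])
  refine ⟨e.extendSubtype, fun i => ?_⟩
  by_cases hi : i ∈ t
  · rw [(mem_filter.1 (ht hi)).2]
    exact Bool.le_true _
  · rw [Function.comp_apply, Bool.eq_false_iff.2 (e.extendSubtype_not_mem i hi)]
    exact Bool.false_le _

/-- The average of a function over all permutations of the coordinates. -/
noncomputable def symmetrize (f : Cube n → ℝ) (x : Cube n) : ℝ :=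
  𝔼 σ : Equiv.Perm (Fin n), f (x ∘ σ)

theorem symmetrize_comp_perm (f : Cube n → ℝ) (σ : Equiv.Perm (Fin n)) (x : Cube n) :
    symmetrize f (x ∘ σ) = symmetrize f x :=
  Fintype.expect_equiv (Equiv.mulLeft σ) _ _ fun _ => rfl

theorem symmetrize_mem_Icc {f : Cube n → ℝ} {a b : ℝ} (hf : ∀ x, f x ∈ Set.Icc a b)
    (x : Cube n) : symmetrize f x ∈ Set.Icc a b :=
  ⟨le_expect univ_nonempty fun _ _ => (hf _).1, expect_le univ_nonempty fun _ _ => (hf _).2⟩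

theorem symmetrize_le_of_signSum_le {f : Cube n → ℝ} (hf : Monotone f) {x y : Cube n}
    (h : signSum x ≤ signSum y) : symmetrize f x ≤ symmetrize f y := by
  obtain ⟨σ, hσ⟩ := exists_perm_comp_le h
  rw [← symmetrize_comp_perm f σ x]
  exact expect_le_expect fun τ _ => hf fun i => hσ (τ i)

theorem expect_symmetrize_mul (f : Cube n → ℝ) {g : Cube n → ℝ}
    (hg : ∀ (σ : Equiv.Perm (Fin n)) x, g (x ∘ σ) = g x) :
    𝔼 x, symmetrize f x * g x = 𝔼 x, f x * g x := by
  have h_perm (σ : Equiv.Perm (Fin n)) : 𝔼 x : Cube n, f (x ∘ σ) * g x = 𝔼 x, f x * g x := by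
    simpa only [hg] using expect_comp_perm σ fun x => f x * g x
  simp only [symmetrize, expect_mul]
  rw [expect_comm]
  simp only [h_perm, Fintype.expect_const]

theorem exists_symmetrize_threshold {f : Cube n → ℝ} (hf : Monotone f) :
    ∃ a ∈ Set.range (symmetrize f), (∀ x, signSum x ≤ 0 → symmetrize f x ≤ a) ∧
      ∀ x, 0 < signSum x → a ≤ symmetrize f x := by
  have h_nonempty : ({x | signSum x ≤ 0} : Finset (Cube n)).Nonempty :=
    ⟨fun _ => false, by simp [signSum_eq_card]⟩
  obtain ⟨z, hz, h_max⟩ := exists_max_image _ (symmetrize f) h_nonempty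
  simp only [mem_filter, mem_univ, true_and] at hz h_max
  exact ⟨_, ⟨z, rfl⟩, h_max, fun x hx => symmetrize_le_of_signSum_le hf (hz.trans hx.le)⟩

/-! ### Covariance with the majority family -/

theorem cov_eq_expect_ind_mul (A B : Finset (Cube n)) :
    cov A B = 𝔼 x, ind A x * (ind B x - mu B) := by
  simp only [mul_sub, expect_sub_distrib, ← expect_mul, ← ind_inter, ← mu_eq_expect_ind, cov]

theorem cov_majority_eq_expect (A : Finset (Cube n)) (a : ℝ) :
    cov A (majority n)
      = 𝔼 x, (symmetrize (ind A) x - a) * (ind (majority n) x - mu (majority n)) := by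
  have h_symm (σ : Equiv.Perm (Fin n)) (x : Cube n) :
      ind (majority n) (x ∘ σ) - mu (majority n) = ind (majority n) x - mu (majority n) := by
    simp only [ind, mem_majority, signSum_comp_perm]
  have h_mean : 𝔼 x, (ind (majority n) x - mu (majority n)) = 0 := by
    rw [expect_sub_distrib, ← mu_eq_expect_ind, Fintype.expect_const, sub_self]
  simp only [sub_mul _ a]
  rw [expect_sub_distrib, ← mul_expect, h_mean, mul_zero, sub_zero,
    expect_symmetrize_mul _ h_symm, cov_eq_expect_ind_mul]

theorem expect_abs_symmetrize_sub_le (hn : 0 < n) {A : Finset (Cube n)} {a : ℝ}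
    (h_le : ∀ x, signSum x ≤ 0 → symmetrize (ind A) x ≤ a)
    (h_ge : ∀ x, 0 < signSum x → a ≤ symmetrize (ind A) x) :
    𝔼 x, |symmetrize (ind A) x - a| ≤ 4 * cov A (majority n) := by
  rw [cov_majority_eq_expect A a, mul_expect]
  refine expect_le_expect fun x _ => ?_
  rcases le_or_gt (signSum x) 0 with hx | hx
  · have hB : ind (majority n) x = 0 := by simp [ind, mem_majority, hx]
    have hq := sub_nonpos.2 (h_le x hx)
    rw [abs_of_nonpos hq, hB]
    linarith [mul_nonneg (neg_nonneg.2 hq) (sub_nonneg.2 (one_quarter_le_mu_majority hn))]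
  · have hB : ind (majority n) x = 1 := by simp [ind, mem_majority, hx]
    have hq := sub_nonneg.2 (h_ge x hx)
    rw [abs_of_nonneg hq, hB]
    linarith [mul_nonneg hq (sub_nonneg.2 (mu_majority_le_one_half (n := n)))]

theorem IsIncreasing.sum_influence_eq_two_mul_expect_abs {A : Finset (Cube n)}
    (hA : IsIncreasing A) {a : ℝ} (h_le : ∀ x, signSum x ≤ 0 → symmetrize (ind A) x ≤ a)
    (h_ge : ∀ x, 0 < signSum x → a ≤ symmetrize (ind A) x) :
    ∑ i, influence i A = 2 * 𝔼 x, |symmetrize (ind A) x - a| * |signSum x| := by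
  have h_sign (x : Cube n) : |symmetrize (ind A) x - a| * |signSum x|
      = (symmetrize (ind A) x - a) * signSum x := by
    rw [← abs_mul, abs_of_nonneg]
    rcases le_or_gt (signSum x) 0 with hx | hx
    · exact mul_nonneg_of_nonpos_of_nonpos (sub_nonpos.2 (h_le x hx)) hx
    · exact mul_nonneg (sub_nonneg.2 (h_ge x hx)) hx.le
  simp only [h_sign, sub_mul]
  rw [expect_sub_distrib, ← mul_expect, expect_signSum, mul_zero, sub_zero,
    expect_symmetrize_mul _ signSum_comp_perm, hA.sum_influence_eq_two_mul_expect]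

theorem IsIncreasing.cov_majority_nonneg {A : Finset (Cube n)} (hA : IsIncreasing A) :
    0 ≤ cov A (majority n) := by
  rcases Nat.eq_zero_or_pos n with rfl | hn
  · simp [cov, majority, mu]
  obtain ⟨a, -, h_le, h_ge⟩ := exists_symmetrize_threshold hA.monotone_ind
  have h_nonneg : 0 ≤ 𝔼 x, |symmetrize (ind A) x - a| := expect_nonneg fun x _ => abs_nonneg _
  linarith [expect_abs_symmetrize_sub_le hn h_le h_ge]

theorem IsIncreasing.sum_influence_le {A : Finset (Cube n)} (hA : IsIncreasing A) {M : ℝ}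
    (hM : 0 ≤ M) : ∑ i, influence i A
      ≤ 8 * M * cov A (majority n) + 4 * n * Real.exp (-(M ^ 2 / (2 * n))) := by
  rcases Nat.eq_zero_or_pos n with rfl | hn
  · simpa using mul_nonneg (mul_nonneg (by norm_num) hM) hA.cov_majority_nonneg
  obtain ⟨_, ⟨z, rfl⟩, h_le, h_ge⟩ := exists_symmetrize_threshold hA.monotone_ind
  have h_gap (x : Cube n) :
      |symmetrize (ind A) x - symmetrize (ind A) z| ∈ Set.Icc (0 : ℝ) 1 := by
    have hx := symmetrize_mem_Icc (ind_mem_Icc A) x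
    have hz := symmetrize_mem_Icc (ind_mem_Icc A) z
    exact ⟨abs_nonneg _, abs_sub_le_iff.2 ⟨by linarith [hx.2, hz.1], by linarith [hx.1, hz.2]⟩⟩
  have h_cov := mul_le_mul_of_nonneg_left (expect_abs_symmetrize_sub_le hn h_le h_ge) hM
  rw [hA.sum_influence_eq_two_mul_expect_abs h_le h_ge]
  linarith [expect_mul_abs_signSum_le h_gap hM]

theorem mul_exp_neg_eight_mul_log_le {m v : ℝ} (hm : 1 ≤ m) (hv : 0 < v) (hv4 : v ≤ 1 / 4) :
    4 * m * Real.exp (-(8 * Real.log (m / v))) ≤ v * Real.log (m / v) / 5 := by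
  have h_ratio : 4 ≤ m / v := by
    rw [le_div_iff₀ hv]
    linarith
  have h_log : 1 ≤ Real.log (m / v) := by
    rw [Real.le_log_iff_exp_le (by positivity)]
    linarith [Real.exp_one_lt_d9]
  have h_exp : Real.exp (-(8 * Real.log (m / v))) = ((m / v) ^ 8)⁻¹ := by
    rw [Real.exp_neg, ← Nat.cast_ofNat, Real.exp_nat_mul, Real.exp_log (by positivity)]
  have h_pow : (4 : ℝ) ^ 7 ≤ (m / v) ^ 7 := by gcongr
  calc 4 * m * Real.exp (-(8 * Real.log (m / v))) = 4 * v / (m / v) ^ 7 := by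
        rw [h_exp]
        field_simp
    _ ≤ 4 * v / 4 ^ 7 := by gcongr
    _ ≤ v * 1 / 5 := by linarith
    _ ≤ v * Real.log (m / v) / 5 := by gcongr

theorem cov_self_mul_sqrt_log_le {A : Finset (Cube n)} (hA : IsIncreasing A) (hr : IsRegular A) :
    cov A A * √(Real.log (n / cov A A)) ≤ 160 * √n * cov A (majority n) := by
  set v := cov A A
  set L := Real.log (n / v)
  rcases (cov_self_nonneg A).eq_or_lt with hv | hv
  · have h_nonneg := hA.cov_majority_nonneg
    rw [show v = 0 from hv.symm, zero_mul]
    positivity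
  rcases Nat.eq_zero_or_pos n with rfl | hn
  · simp [L]
  have hn1 : (1 : ℝ) ≤ n := Nat.one_le_cast.2 hn
  have hv4 : v ≤ 1 / 4 := cov_self_le_one_quarter A
  have hL : 0 < L := Real.log_pos ((one_lt_div hv).2 (by linarith))
  have h_exponent : (4 * (√n * √L)) ^ 2 / (2 * n) = 8 * L := by
    rw [mul_pow, mul_pow, Real.sq_sqrt (by positivity), Real.sq_sqrt hL.le]
    field_simp
    norm_num
  have h_upper := hA.sum_influence_le (M := 4 * (√n * √L)) (by positivity)
  rw [h_exponent] at h_upper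
  have h_tail : 4 * n * Real.exp (-(8 * L)) ≤ v * L / 5 := mul_exp_neg_eight_mul_log_le hn1 hv hv4
  have h_lower : v * L ≤ 5 / 2 * ∑ i, influence i A := hr.cov_self_mul_log_le
  refine le_of_mul_le_mul_right ?_ (Real.sqrt_pos.2 hL)
  calc v * √L * √L = v * L := by rw [mul_assoc, Real.mul_self_sqrt hL.le]
    _ ≤ 160 * √n * cov A (majority n) * √L := by linarith

end DiscreteCube

open DiscreteCube in
theorem mainTheorem4_general :
    ∃ c : ℝ, 0 < c ∧
      ∀ (n : ℕ) (A : Finset (Cube n)), IsIncreasing A → IsRegular A →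
        c * cov A A * (√(Real.log n) / √n) ≤ cov A (majority n) := by
  refine ⟨1 / 160, by norm_num, fun n A hA hr => ?_⟩
  rcases Nat.eq_zero_or_pos n with rfl | hn
  · simpa using hA.cov_majority_nonneg
  have h_log : cov A A * √(Real.log n) ≤ cov A A * √(Real.log (n / cov A A)) := by
    rcases (cov_self_nonneg A).eq_or_lt with hv | hv
    · rw [← hv, zero_mul, zero_mul]
    · gcongr
      exact le_div_self n.cast_nonneg hv (by linarith [cov_self_le_one_quarter A])
  rw [← mul_div_assoc, div_le_iff₀ (by positivity)]
  linarith [cov_self_mul_sqrt_log_le hA hr]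

theorem mainTheorem4 :
    ∃ c : ℝ, 0 < c ∧
      ∀ (n : ℕ) (A : Finset (DiscreteCube.Cube n)),
        DiscreteCube.IsIncreasing A → DiscreteCube.IsRegular A → DiscreteCube.IsBalanced A →
          c * (Real.sqrt (Real.log n) / Real.sqrt n) ≤
            DiscreteCube.cov A (DiscreteCube.majority n) := by
  obtain ⟨c, hc, h⟩ := mainTheorem4_general
  exact ⟨c * (1 / 4), by positivity, fun n A hA hr hb => hb.cov_self ▸ h n A hA hr⟩
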